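/- Let $1\le Q<N$ be integers and let $P\in\mathbb{C}^{N\times Q}$ have rank $Q$ and no zero row (so that every fading coefficient has positive variance). Consider the correlated Rayleigh block-fading SIMO channel with $Q$ receive antennas and block length $N$, whose input-output relation within a block is $$y=\sqrt{\mathrm{SNR}}\,\bigl(I_Q\otimes \operatorname{diag}(x)P\bigr)s+w ,$$ where $x\in\mathbb{C}^N$ is the input, and $s\in\mathbb{C}^{Q^2}$ and $w\in\mathbb{C}^{QN}$ have i.i.d. circularly symmetric complex Gaussian entries of mean $0$ and variance $1$, with $x,s,w$ mutually independent. Its noncoherent capacity is $$C(\mathrm{SNR})=\frac1N\sup I(x;y),$$ the supremum being over all probability distributions of $x$ on $\mathbb{C}^N$ with $\mathbb{E}\|x\|^2\le N$, and mutual information being measured in bits. Suppose that there is a set $\mathcal I\subset\{1,\dots,N\}$ of cardinality $Q+1$ such that any $Q$ of the rows of $P$ with indices in $\mathcal I$ are linearly independent. Then there is a constant $c\in\mathbb{R}$, independent of $\mathrm{SNR}$, such that for all sufficiently large $\mathrm{SNR}$ $$C(\mathrm{SNR})\ \ge\ \Bigl(1-\frac1N\Bigr)\log_2(\mathrm{SNR})+c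 .$$ In particular $\liminf_{\mathrm{SNR}\to\infty} C(\mathrm{SNR})/\log_2(\mathrm{SNR})\ge 1-1/N$, and for $Q\ge 2$ this limit inferior is strictly larger than $1-Q/N$. -/

import Mathlib

open MeasureTheory ProbabilityTheory Filter
open scoped ENNReal NNReal Kronecker

noncomputable section

namespace SIMO

/-- The standard proper (circularly symmetric) complex Gaussian law on `ℂ`: real and imaginary
parts are independent, centred, and of variance `1/2`, so the total variance is `1`. -/
def stdComplexGaussian : Measure ℂ :=
  ((gaussianReal 0 (1 / 2)).prod (gaussianReal 0 (1 / 2))).map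
    (fun p : ℝ × ℝ => (⟨p.1, p.2⟩ : ℂ))

/-- The law of a jointly proper Gaussian vector with mean zero and identity covariance:
independent standard complex Gaussian components. -/
def stdComplexGaussianVec (ι : Type*) [Fintype ι] : Measure (ι → ℂ) :=
  Measure.pi (fun _ : ι => stdComplexGaussian)

/-- The mutual information, in bits, of two random variables `X` and `Y`: the relative entropy of
their joint law with respect to the product of the marginal laws (`klDiv` is in nats). -/
def mutualInfo {Ω α β : Type*} [MeasurableSpace Ω] [MeasurableSpace α] [MeasurableSpace β]
    (X : Ω → α) (Y : Ω → β) (μ : Measure Ω) : ℝ≥0∞ :=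
  InformationTheory.klDiv (μ.map (fun ω => (X ω, Y ω))) ((μ.map X).prod (μ.map Y))
    / ENNReal.ofReal (Real.log 2)

variable {N Q : ℕ}

/-- The output of the channel over one block, for `R` receive antennas:
`y = √SNR (I_R ⊗ diag(x) P) s + w`. The component `(m, i)` belongs to antenna `m`
and symbol time `i`. -/
def channelOutput (P : Matrix (Fin N) (Fin Q) ℂ) (R : ℕ) (snr : ℝ)
    (x : Fin N → ℂ) (s : Fin R × Fin Q → ℂ) (w : Fin R × Fin N → ℂ) : Fin R × Fin N → ℂ :=
  ((Real.sqrt snr : ℝ) : ℂ) •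
      Matrix.mulVec ((1 : Matrix (Fin R) (Fin R) ℂ) ⊗ₖ (Matrix.diagonal x * P)) s + w

/-- The joint law of the input `x` (with law `μ`), the whitened fading vector `s`, and the
noise `w`, which are independent. -/
def blockLaw (Q R : ℕ) (μ : Measure (Fin N → ℂ)) :
    Measure ((Fin N → ℂ) × (Fin R × Fin Q → ℂ) × (Fin R × Fin N → ℂ)) :=
  μ.prod ((stdComplexGaussianVec (Fin R × Fin Q)).prod (stdComplexGaussianVec (Fin R × Fin N)))

/-- The mutual information (in bits) between the input and the output over one block, when the
input has law `μ`; neither fading nor noise is observed. -/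
def blockMutualInfo (P : Matrix (Fin N) (Fin Q) ℂ) (R : ℕ) (snr : ℝ)
    (μ : Measure (Fin N → ℂ)) : ℝ≥0∞ :=
  mutualInfo (fun ω : (Fin N → ℂ) × (Fin R × Fin Q → ℂ) × (Fin R × Fin N → ℂ) => ω.1)
    (fun ω => channelOutput P R snr ω.1 ω.2.1 ω.2.2) (blockLaw Q R μ)

/-- Input laws satisfying the average-power constraint `E ‖x‖² ≤ N`. -/
def IsAdmissibleInput (μ : Measure (Fin N → ℂ)) : Prop :=
  IsProbabilityMeasure μ ∧ ∫⁻ x, ∑ i, ‖x i‖ₑ ^ 2 ∂μ ≤ (N : ℝ≥0∞)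

/-- The noncoherent capacity, in bits per channel use, of the correlated block-fading channel with
`R` receive antennas. -/
def capacity (P : Matrix (Fin N) (Fin Q) ℂ) (R : ℕ) (snr : ℝ) : ℝ≥0∞ :=
  (⨆ (μ : Measure (Fin N → ℂ)) (_ : IsAdmissibleInput μ), blockMutualInfo P R snr μ) / (N : ℝ≥0∞)

/-- The (lower) capacity pre-log: the limit inferior of `C(SNR) / log₂ SNR` as `SNR → ∞`. -/
def lowerPreLog (P : Matrix (Fin N) (Fin Q) ℂ) (R : ℕ) : EReal :=
  liminf (fun snr : ℝ => ((capacity P R snr : ℝ≥0∞) : EReal) / ((Real.logb 2 snr : ℝ) : EReal))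
    atTop

/-- Some `(Q + 1) × Q` row-submatrix of `P` has every set of `Q` rows linearly independent. -/
def HasSparkProperty (P : Matrix (Fin N) (Fin Q) ℂ) : Prop :=
  ∃ I : Finset (Fin N), I.card = Q + 1 ∧
    ∀ K ⊆ I, K.card = Q → LinearIndependent ℂ (fun i : K => P.row i)

end SIMO

end

/-! Choose a frame of `Q` linearly independent rows of `P` and a pilot time `i₀` whose row has only
nonzero coordinates `b i₀ q` in that frame; the spark property provides both. Put `u i = (x i)⁻¹`
and let the pilot be `x i₀ = 1`. Without noise, `u i * y (m, i)` is a linear form in the fading of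
antenna `m`, so it equals `∑ q, b i q * u (e q) * y (m, e q)`. At `i = i₀` the `Q` antennas give `Q`
linear equations for the `Q` frame reciprocals, solved by Cramer's rule; one antenna then yields
every remaining `u i`. Thus `N - 1` complex numbers are recovered from the output, with an error of
order `t⁻¹` for `t = √SNR`.

Recovery at scale `t⁻¹` in real dimension 2 is worth `log (t ^ 2)` nats per symbol. To prove this,
`ofReal_le_klDiv_add` is applied with a penalty `L` summing `3 * log (1 + t * error)`. Under the
product law the test function has exponential mean at most 1 (`exists_lintegral_recipLaw_le`), and
under the joint law `L` has bounded mean (`exists_lintegral_log_error_le`). The latter needs only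
first inverse moments of the Cramer determinant and of one output, since the logarithm separates the
factors. -/

namespace SIMO

/-! ### Variational bound for relative entropy, and product integrals -/

/-- A Donsker–Varadhan lower bound on the relative entropy, for a test function `c - L` with
`L ≥ 0`. -/
lemma ofReal_le_klDiv_add {α : Type*} [MeasurableSpace α] (μ ν : Measure α)
    [IsProbabilityMeasure μ] [IsProbabilityMeasure ν] {c : ℝ} (hc : 0 ≤ c) {L : α → ℝ}
    (hL0 : ∀ a, 0 ≤ L a) (hL : Measurable L)
    (hexp : ∫⁻ a, ENNReal.ofReal (Real.exp (c - L a)) ∂ν ≤ 1) :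
    ENNReal.ofReal c ≤ InformationTheory.klDiv μ ν + ∫⁻ a, ENNReal.ofReal (L a) ∂μ := by
  by_cases hac : μ ≪ ν
  swap
  · simp [InformationTheory.klDiv_of_not_ac hac]
  rw [InformationTheory.klDiv_eq_lintegral_klFun_of_ac hac,
    ← lintegral_rnDeriv_mul hac (by fun_prop)]
  -- Fenchel–Young inequality: the convex conjugate of `klFun` is `exp f - 1`.
  have key : ∀ a f : ℝ, 0 ≤ a → a * f + 1 ≤ InformationTheory.klFun a + Real.exp f := by
    intro a f ha
    rw [InformationTheory.klFun_apply]
    rcases ha.eq_or_lt with rfl | ha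
    · simp [Real.exp_nonneg]
    · have h := Real.add_one_le_exp (f - Real.log a)
      rw [Real.exp_sub, Real.exp_log ha, le_div_iff₀ ha] at h
      nlinarith
  -- The extra 1 pays for the exponential moment; `L` is moved to the right so that every integrand
  -- is nonnegative.
  have hint : ENNReal.ofReal c + 1 ≤ (∫⁻ a, ENNReal.ofReal
      (InformationTheory.klFun (μ.rnDeriv ν a).toReal) ∂ν +
      ∫⁻ a, μ.rnDeriv ν a * ENNReal.ofReal (L a) ∂ν) + 1 := by
    calc ENNReal.ofReal c + 1
        = ∫⁻ a, (μ.rnDeriv ν a * ENNReal.ofReal c + 1) ∂ν := by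
          rw [lintegral_add_right _ measurable_const, lintegral_mul_const _ (by fun_prop),
            Measure.lintegral_rnDeriv hac]
          simp
      _ ≤ ∫⁻ a, (ENNReal.ofReal (InformationTheory.klFun (μ.rnDeriv ν a).toReal)
            + μ.rnDeriv ν a * ENNReal.ofReal (L a)
            + ENNReal.ofReal (Real.exp (c - L a))) ∂ν := by
          refine lintegral_mono_ae ?_
          filter_upwards [μ.rnDeriv_lt_top ν] with a ha
          have h0 : 0 ≤ (μ.rnDeriv ν a).toReal := ENNReal.toReal_nonneg
          have h1 : μ.rnDeriv ν a = ENNReal.ofReal (μ.rnDeriv ν a).toReal :=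
            (ENNReal.ofReal_toReal ha.ne).symm
          have hk := InformationTheory.klFun_nonneg h0
          set t := (μ.rnDeriv ν a).toReal
          rw [h1, ← ENNReal.ofReal_mul h0, ← ENNReal.ofReal_mul h0, ← ENNReal.ofReal_one,
            ← ENNReal.ofReal_add (mul_nonneg h0 hc) zero_le_one,
            ← ENNReal.ofReal_add hk (mul_nonneg h0 (hL0 a)),
            ← ENNReal.ofReal_add (add_nonneg hk (mul_nonneg h0 (hL0 a))) (Real.exp_nonneg _)]
          refine ENNReal.ofReal_le_ofReal ?_
          have := key t (c - L a) h0
          nlinarith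
      _ ≤ _ := by
          rw [lintegral_add_left (by fun_prop), lintegral_add_left (by fun_prop)]
          gcongr
  exact (ENNReal.add_le_add_iff_right ENNReal.one_ne_top).1 hint

/-- Once the output is fixed, the exponential test function is a product over the independent
symbols. -/
lemma lintegral_pi_prod_eq_prod_lintegral {ι : Type*} [Fintype ι] (μ : ι → Measure ℂ)
    [∀ i, IsProbabilityMeasure (μ i)] {F : ι → ℂ → ℝ≥0∞} (hF : ∀ i, Measurable (F i)) :
    ∫⁻ x, ∏ i, F i (x i) ∂(Measure.pi μ) = ∏ i, ∫⁻ z, F i z ∂(μ i) := by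
  refine (lintegral_prod_eq_prod_lintegral_of_indepFun Finset.univ
    (fun i (x : ι → ℂ) => F i (x i)) (iIndepFun_pi fun i => (hF i).aemeasurable)
    fun i => (hF i).comp (measurable_pi_apply i)).trans ?_
  refine Finset.prod_congr rfl fun i _ => ?_
  exact (measurePreserving_eval μ i).lintegral_comp (hF i)

/-! ### Inverse moments of Gaussian affine forms and determinants -/

/-- The density peaks at `1 / √π`, below 1. Domination by the translation-invariant Lebesgue measure
makes the inverse moments uniform in the shift. -/
lemma gaussianReal_half_le : gaussianReal 0 (1 / 2) ≤ (volume : Measure ℝ) := by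
  rw [gaussianReal_of_var_ne_zero _ (by norm_num)]
  conv_rhs => rw [← withDensity_one (μ := (volume : Measure ℝ))]
  refine withDensity_mono (ae_of_all _ fun x => ?_)
  rw [gaussianPDF, Pi.one_apply, ← ENNReal.ofReal_one]
  refine ENNReal.ofReal_le_ofReal ?_
  rw [gaussianPDFReal]
  refine mul_le_one₀ ?_ (Real.exp_nonneg _) ?_
  · refine inv_le_one_of_one_le₀ ?_
    rw [Real.one_le_sqrt]
    have := Real.pi_gt_three
    push_cast
    linarith
  · rw [Real.exp_le_one_iff]
    push_cast
    have := sq_nonneg (x - 0)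
    linarith

instance : IsProbabilityMeasure stdComplexGaussian :=
  Measure.isProbabilityMeasure_map
    (Complex.measurableEquivRealProd.symm.measurable.aemeasurable)

instance (ι : Type*) [Fintype ι] : IsProbabilityMeasure (stdComplexGaussianVec ι) := by
  unfold stdComplexGaussianVec; infer_instance

lemma stdComplexGaussian_le : stdComplexGaussian ≤ (volume : Measure ℂ) := by
  rw [← Complex.volume_preserving_equiv_real_prod.symm.map_eq]
  exact Measure.map_mono (Measure.prod_mono gaussianReal_half_le gaussianReal_half_le)
    Complex.measurableEquivRealProd.symm.measurable

/-- The integral of `‖z‖⁻¹` over the unit disc. -/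
noncomputable def discInvNorm : ℝ≥0∞ := ∫⁻ z : ℂ, (Metric.ball (0 : ℂ) 1).indicator (fun z => ‖z‖ₑ⁻¹) z

/-- In polar coordinates the Jacobian `r` cancels the singularity `r⁻¹`. -/
lemma discInvNorm_lt_top : discInvNorm < ∞ := by
  unfold discInvNorm
  rw [← Complex.lintegral_comp_polarCoord_symm]
  calc _ ≤ ∫⁻ p in polarCoord.target, (Set.Iio (1:ℝ) ×ˢ Set.univ).indicator (fun _ => 1) p := by
        refine setLIntegral_mono' polarCoord.open_target.measurableSet fun p hp => ?_
        have hp0 : 0 < p.1 := by simpa [polarCoord] using hp.1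
        have hn : ‖Complex.polarCoord.symm p‖ = p.1 := by
          rw [Complex.norm_polarCoord_symm, abs_of_pos hp0]
        by_cases h1 : p.1 < 1
        · rw [Set.indicator_of_mem, Set.indicator_of_mem]
          · rw [← ofReal_norm, hn, smul_eq_mul, ENNReal.mul_inv_cancel] <;> simp [hp0]
          · simp [h1]
          · rw [mem_ball_zero_iff, hn]; exact h1
        · rw [Set.indicator_of_notMem]
          · simp
          · rw [mem_ball_zero_iff, hn]; exact h1
    _ ≤ ∫⁻ p, (Set.Ioo (0:ℝ) 1 ×ˢ Set.Ioo (-Real.pi) Real.pi).indicator (fun _ => 1) p := by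
        rw [← lintegral_indicator polarCoord.open_target.measurableSet]
        refine lintegral_mono fun p => ?_
        simp only [Set.indicator, polarCoord, Set.mem_prod, Set.mem_Ioi, Set.mem_Ioo, Set.mem_Iio,
          Set.mem_univ, and_true]
        split_ifs <;> simp_all
    _ < ∞ := by
        rw [lintegral_indicator (by measurability), setLIntegral_const, Measure.volume_eq_prod,
          Measure.prod_prod]
        simp

/-- A bound on `E ‖z + r‖⁻¹` for a standard complex Gaussian `z`, uniform in `r`. -/
noncomputable def invMoment : ℝ≥0∞ := 1 + discInvNorm

lemma lintegral_inv_enorm_add_le (r : ℂ) :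
    ∫⁻ z, ‖z + r‖ₑ⁻¹ ∂stdComplexGaussian ≤ invMoment := by
  have hm : Measurable ((Metric.ball (0 : ℂ) 1).indicator (fun z : ℂ => ‖z‖ₑ⁻¹)) :=
    (by fun_prop : Measurable (fun z : ℂ => ‖z‖ₑ⁻¹)).indicator measurableSet_ball
  calc ∫⁻ z, ‖z + r‖ₑ⁻¹ ∂stdComplexGaussian
      ≤ ∫⁻ z, (1 + (Metric.ball (0 : ℂ) 1).indicator (fun z => ‖z‖ₑ⁻¹) (z + r))
          ∂stdComplexGaussian := by
        refine lintegral_mono fun z => ?_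
        by_cases h : z + r ∈ Metric.ball (0 : ℂ) 1
        · simp only [Set.indicator_of_mem h]; exact le_add_self
        · simp only [Set.indicator_of_notMem h, add_zero]
          rw [ENNReal.inv_le_one, ← ofReal_norm, ENNReal.one_le_ofReal]
          simpa using h
    _ = 1 + ∫⁻ z, (Metric.ball (0 : ℂ) 1).indicator (fun z => ‖z‖ₑ⁻¹) (z + r)
          ∂stdComplexGaussian := by
        rw [lintegral_add_left measurable_const]; simp
    _ ≤ 1 + ∫⁻ z, (Metric.ball (0 : ℂ) 1).indicator (fun z => ‖z‖ₑ⁻¹) (z + r) := by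
        gcongr
        exact stdComplexGaussian_le
    _ = invMoment := by rw [lintegral_add_right_eq_self]; rfl

lemma invMoment_ne_top : invMoment ≠ ∞ := by
  simp [invMoment, discInvNorm_lt_top.ne]

lemma lintegral_inv_enorm_mul_add_le (c r : ℂ) :
    ∫⁻ z, ‖z * c + r‖ₑ⁻¹ ∂stdComplexGaussian ≤ invMoment * ‖c‖ₑ⁻¹ := by
  rcases eq_or_ne c 0 with rfl | hc
  -- Here `0⁻¹ = ∞`, so the right-hand side is infinite.
  · have : invMoment ≠ 0 := by simp [invMoment]
    simp [ENNReal.mul_top this]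
  · have h : ∀ z : ℂ, ‖z * c + r‖ₑ⁻¹ = ‖z + r / c‖ₑ⁻¹ * ‖c‖ₑ⁻¹ := fun z => by
      rw [← ENNReal.mul_inv (by simp) (by simp), ← enorm_mul]
      congr 2; field_simp
    simp_rw [h]
    rw [lintegral_mul_const _ (by fun_prop)]
    gcongr
    exact lintegral_inv_enorm_add_le _

/-- Integrate out the coordinate `j` alone: the others freeze the slope `C` and the intercept `R`,
and the scalar bound does not see `R`. -/
lemma lintegral_inv_enorm_affine_le {ι : Type*} [Fintype ι] [DecidableEq ι] (j : ι)
    {C R : (ι → ℂ) → ℂ} (hC : Measurable C) (hR : Measurable R)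
    (hCj : ∀ s t, C (Function.update s j t) = C s)
    (hRj : ∀ s t, R (Function.update s j t) = R s) :
    ∫⁻ s, ‖s j * C s + R s‖ₑ⁻¹ ∂stdComplexGaussianVec ι
      ≤ invMoment * ∫⁻ s, ‖C s‖ₑ⁻¹ ∂stdComplexGaussianVec ι := by
  rw [← lintegral_const_mul _ (by fun_prop)]
  refine lintegral_le_of_lmarginal_le {j} (by fun_prop) (by fun_prop) fun s => ?_
  simp only [lmarginal_singleton, Function.update_self, hCj, hRj]
  refine (lintegral_inv_enorm_mul_add_le _ _).trans ?_
  simp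

lemma lintegral_inv_enorm_dotProduct_le {ι : Type*} [Fintype ι] [DecidableEq ι] (c : ι → ℂ)
    (r : ℂ) (j : ι) :
    ∫⁻ s, ‖∑ i, c i * s i + r‖ₑ⁻¹ ∂stdComplexGaussianVec ι ≤ invMoment * ‖c j‖ₑ⁻¹ := by
  have h := lintegral_inv_enorm_affine_le (ι := ι) j (C := fun _ => c j)
    (R := fun s => ∑ i ∈ Finset.univ.erase j, c i * s i + r) (by fun_prop) (by fun_prop)
    (fun _ _ => rfl) (fun s t => by
      congr 1
      refine Finset.sum_congr rfl fun i hi => ?_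
      rw [Function.update_of_ne (Finset.ne_of_mem_erase hi)])
  refine le_trans (le_of_eq ?_) (h.trans (by simp))
  refine lintegral_congr fun s => ?_
  rw [← Finset.add_sum_erase _ _ (Finset.mem_univ j), mul_comm (s j), add_assoc]

/-- By Laplace expansion the determinant is affine in its corner entry, with the complementary minor
as slope; integrating that entry costs one factor `invMoment` and leaves a smaller determinant.
Injectivity of `σ` keeps the corner variable out of the minors, and a general `σ` lets the induction
stay on the same index type. -/
lemma lintegral_inv_enorm_det_add_le {ι : Type*} [Fintype ι] [DecidableEq ι] :
    ∀ {n : ℕ} (σ : Fin n → Fin n → ι) (_ : Function.Injective (Function.uncurry σ))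
      (B : Matrix (Fin n) (Fin n) ℂ),
      ∫⁻ s, ‖((Matrix.of fun i j => s (σ i j)) + B).det‖ₑ⁻¹ ∂stdComplexGaussianVec ι
        ≤ invMoment ^ n := by
  intro n
  induction n with
  | zero => intro σ hσ B; simp
  | succ n ih =>
    intro σ hσ B
    have hσ' : ∀ {i j k l}, σ i j = σ k l → i = k ∧ j = l := fun {i j k l} h => by
      simpa using @hσ (i, j) (k, l) h
    let M : (ι → ℂ) → Matrix (Fin (n+1)) (Fin (n+1)) ℂ := fun s =>
      (Matrix.of fun i j => s (σ i j)) + B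
    have hM : ∀ i j, Measurable fun s => M s i j := fun i j => by
      simp only [M, Matrix.add_apply, Matrix.of_apply]; fun_prop
    have hdet : ∀ k : Fin (n+1),
        Measurable fun s => ((M s).submatrix Fin.succ k.succAbove).det := fun k => by
      simp only [Matrix.det_apply, Matrix.submatrix_apply]
      have := hM
      fun_prop
    have hMj : ∀ i j s t, (i ≠ 0 ∨ j ≠ 0) →
        M (Function.update s (σ 0 0) t) i j = M s i j := fun i j s t h => by
      simp only [M, Matrix.add_apply, Matrix.of_apply]
      rw [Function.update_of_ne]
      intro h'
      have := hσ' h'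
      tauto
    have hsub : ∀ s t k, (M (Function.update s (σ 0 0) t)).submatrix Fin.succ (Fin.succAbove k)
        = (M s).submatrix Fin.succ k.succAbove := fun s t k => by
      ext i j
      exact hMj _ _ _ _ (Or.inl (Fin.succ_ne_zero i))
    have h := lintegral_inv_enorm_affine_le (ι := ι) (σ 0 0)
      (C := fun s => ((M s).submatrix Fin.succ (Fin.succAbove 0)).det)
      (R := fun s => B 0 0 * ((M s).submatrix Fin.succ (Fin.succAbove 0)).det
        + ∑ k : Fin n, (-1) ^ ((k.succ : Fin (n+1)) : ℕ) * M s 0 k.succ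
          * ((M s).submatrix Fin.succ (Fin.succAbove k.succ)).det) (hdet 0)
      (by have := hM; have := hdet; fun_prop)
      (fun s t => by simp only [hsub])
      (fun s t => by
        simp only [hsub]
        congr 1
        refine Finset.sum_congr rfl fun k _ => ?_
        rw [hMj _ _ _ _ (Or.inr (Fin.succ_ne_zero k))])
    have h2 := ih (fun i j => σ i.succ j.succ) (fun p q hpq => by
      have := hσ' hpq
      exact Prod.ext (Fin.succ_injective _ this.1) (Fin.succ_injective _ this.2)) (B.submatrix Fin.succ Fin.succ)
    rw [pow_succ']
    refine le_trans (le_of_eq ?_) (h.trans ?_)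
    · refine lintegral_congr fun s => ?_
      change ‖(M s).det‖ₑ⁻¹ = _
      rw [Matrix.det_succ_row_zero, Fin.sum_univ_succ, ← add_assoc, ← add_mul]
      simp [M]
    · gcongr
      refine le_trans (le_of_eq ?_) h2
      refine lintegral_congr fun s => ?_
      simp only [Fin.succAbove_zero]
      rfl

lemma lintegral_enorm_stdComplexGaussian_ne_top :
    ∫⁻ z, ‖z‖ₑ ∂stdComplexGaussian ≠ ∞ := by
  have hg : ∫⁻ x : ℝ, ‖x‖ₑ ∂(gaussianReal 0 (1 / 2)) < ∞ :=
    ((memLp_id_gaussianReal (μ := 0) (v := 1/2) 1).integrable (by norm_num)).2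
  refine ne_of_lt ?_
  rw [stdComplexGaussian, lintegral_map (by fun_prop)
    (show Measurable fun p : ℝ × ℝ => (⟨p.1, p.2⟩ : ℂ) from
      Complex.measurableEquivRealProd.symm.measurable)]
  calc _ ≤ ∫⁻ p : ℝ × ℝ, (‖p.1‖ₑ + ‖p.2‖ₑ)
        ∂((gaussianReal 0 (1 / 2)).prod (gaussianReal 0 (1 / 2))) := by
        refine lintegral_mono fun p => ?_
        rw [← ofReal_norm, ← ofReal_norm, ← ofReal_norm,
          ← ENNReal.ofReal_add (norm_nonneg _) (norm_nonneg _)]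
        exact ENNReal.ofReal_le_ofReal (Complex.norm_le_abs_re_add_abs_im _)
    _ < ∞ := by
        rw [lintegral_add_left (by fun_prop),
          lintegral_prod _ (by fun_prop), lintegral_prod _ (by fun_prop)]
        simpa using hg

/-! ### The frame and the Cramer estimator of the reciprocals -/

variable {N Q : ℕ}

/-- Under the spark property, `Q` rows of `P` form a basis in which some further row has only
nonzero coordinates. -/
lemma HasSparkProperty.exists_frame {P : Matrix (Fin N) (Fin Q) ℂ} (hP : HasSparkProperty P) :
    ∃ (i₀ : Fin N) (e : Fin Q → Fin N) (b : Matrix (Fin N) (Fin Q) ℂ),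
      (P.submatrix e id).det ≠ 0 ∧ b * P.submatrix e id = P ∧ ∀ q, b i₀ q ≠ 0 := by
  obtain ⟨I, hI, hLI⟩ := hP
  have hdet : ∀ (e : Fin Q → Fin N) (K : Finset (Fin N)), K ⊆ I → K.card = Q →
      Function.Injective e → (∀ q, e q ∈ K) → (P.submatrix e id).det ≠ 0 := by
    intro e K hK hKc he heK
    have h := (hLI K hK hKc).comp (fun q => (⟨e q, heK q⟩ : K)) (fun p q h => he (by simpa using h))
    have h' : LinearIndependent ℂ (P.submatrix e id).row := h
    rw [Matrix.linearIndependent_rows_iff_isUnit, Matrix.isUnit_iff_isUnit_det] at h'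
    exact h'.ne_zero
  obtain ⟨i₀, hi₀⟩ : I.Nonempty := Finset.card_pos.1 (by omega)
  have hK : (I.erase i₀).card = Q := by rw [Finset.card_erase_of_mem hi₀, hI]; rfl
  let e : Fin Q → Fin N := (I.erase i₀).orderEmbOfFin hK
  have he : Function.Injective e := ((I.erase i₀).orderEmbOfFin hK).injective
  have heK : ∀ q, e q ∈ I.erase i₀ := Finset.orderEmbOfFin_mem _ hK
  have hA := hdet e _ (Finset.erase_subset _ _) hK he heK
  have hb : (P * (P.submatrix e id)⁻¹) * P.submatrix e id = P := by
    rw [Matrix.mul_assoc, Matrix.nonsing_inv_mul _ hA.isUnit, Matrix.mul_one]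
  refine ⟨i₀, e, P * (P.submatrix e id)⁻¹, hA, hb, fun q hq => ?_⟩
  set b := P * (P.submatrix e id)⁻¹
  have hrow : P i₀ = ∑ k, b i₀ k • (P.submatrix e id) k := by
    conv_lhs => rw [← hb]
    ext j
    simp [Matrix.mul_apply]
  have hne : ∀ q, e q ≠ i₀ := fun q => Finset.ne_of_mem_erase (heK q)
  -- Exchanging the frame row `q` for the row `i₀` multiplies the determinant by `b i₀ q`; a zero
  -- coordinate would make these `Q` rows dependent.
  refine hdet (Function.update e q i₀) (I.erase (e q)) (Finset.erase_subset _ _)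
    (by rw [Finset.card_erase_of_mem (Finset.mem_of_mem_erase (heK q)), hI]; rfl) ?_ ?_ ?_
  · intro k l hkl
    by_cases hk : k = q <;> by_cases hl : l = q
    · rw [hk, hl]
    · subst hk; simp [hl] at hkl; exact absurd hkl.symm (hne l)
    · subst hl; simp [hk] at hkl; exact absurd hkl (hne k)
    · simp [hk, hl] at hkl; exact he hkl
  · intro k
    by_cases hk : k = q
    · subst hk; simp [hi₀, (hne k).symm]
    · simp [hk, Finset.mem_of_mem_erase (heK k), he.eq_iff]
  · have : P.submatrix (Function.update e q i₀) id
        = (P.submatrix e id).updateRow q (∑ k, b i₀ k • (P.submatrix e id) k) := by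
      rw [← hrow]
      ext k j
      by_cases hk : k = q
      · subst hk; simp
      · simp [hk]
    rw [this, Matrix.det_updateRow_sum, hq, zero_smul]

/-- The square matrix of the outputs at the times in the frame `e`, over all antennas. -/
def frameMatrix (e : Fin Q → Fin N) (y : Fin Q × Fin N → ℂ) : Matrix (Fin Q) (Fin Q) ℂ :=
  Matrix.of fun q m => y (m, e q)

/-- The estimate, from the output, of the reciprocal of the input symbol at time `e q`. -/
noncomputable def frameEstimate (i₀ : Fin N) (e : Fin Q → Fin N) (b : Matrix (Fin N) (Fin Q) ℂ)
    (y : Fin Q × Fin N → ℂ) (q : Fin Q) : ℂ :=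
  ((frameMatrix e y).updateRow q fun m => y (m, i₀)).det / (frameMatrix e y).det / b i₀ q

/-- The estimate, from the output, of the reciprocal of the input symbol at time `i`. -/
noncomputable def recipEstimate (i₀ : Fin N) (e : Fin Q → Fin N) (b : Matrix (Fin N) (Fin Q) ℂ)
    (m₀ : Fin Q) (y : Fin Q × Fin N → ℂ) (i : Fin N) : ℂ :=
  (∑ q, b i q * frameEstimate i₀ e b y q * y (m₀, e q)) / y (m₀, i)

section Estimate

variable {i₀ : Fin N} {e : Fin Q → Fin N} {b : Matrix (Fin N) (Fin Q) ℂ} {m₀ : Fin Q}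
  {y : Fin Q × Fin N → ℂ} {t : ℂ} {v : Fin Q → ℂ}

/-- Cramer's rule by multilinearity: in the replaced row only the `q`-th frame term survives, giving
`b i₀ q * v q` times the determinant, and the noise enters with the factor `t⁻¹`. -/
lemma mul_frameEstimate_sub (ht : t ≠ 0) {n : Fin Q → ℂ}
    (hy : ∀ m, y (m, i₀) = ∑ q, b i₀ q * v q * y (m, e q) + n m / t)
    (hdet : (frameMatrix e y).det ≠ 0) {q : Fin Q} (hb : b i₀ q ≠ 0) :
    t * (frameEstimate i₀ e b y q - v q)
      = ((frameMatrix e y).updateRow q n).det / (frameMatrix e y).det * (b i₀ q)⁻¹ := by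
  have h : (fun m => y (m, i₀))
      = (∑ k, (b i₀ k * v k) • frameMatrix e y k) + t⁻¹ • n := by
    ext m
    simp [hy m, frameMatrix, div_eq_inv_mul]
  rw [frameEstimate, h, Matrix.det_updateRow_add, Matrix.det_updateRow_sum,
    Matrix.det_updateRow_smul]
  simp only [smul_eq_mul]
  field_simp
  ring

lemma mul_recipEstimate_sub (ht : t ≠ 0) {i : Fin N} {u k : ℂ}
    (hy : u * y (m₀, i) = ∑ q, b i q * v q * y (m₀, e q) + k / t) (hyi : y (m₀, i) ≠ 0) :
    t * (recipEstimate i₀ e b m₀ y i - u)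
      = (∑ q, b i q * (t * (frameEstimate i₀ e b y q - v q)) * y (m₀, e q) - k)
        * (y (m₀, i))⁻¹ := by
  have h : ∑ q, b i q * (t * (frameEstimate i₀ e b y q - v q)) * y (m₀, e q)
      = t * (∑ q, b i q * frameEstimate i₀ e b y q * y (m₀, e q)
        - ∑ q, b i q * v q * y (m₀, e q)) := by
    rw [← Finset.sum_sub_distrib, Finset.mul_sum]
    refine Finset.sum_congr rfl fun q _ => ?_
    ring
  have h2 : ∑ q, b i q * v q * y (m₀, e q) = u * y (m₀, i) - k / t := by rw [hy]; ring
  rw [h, h2, recipEstimate]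
  field_simp
  ring

/-- The fixed size `B` and the random size `M` are kept apart, and both denominators stay as factors
for the logarithm. The determinant gives `(B * M) ^ Q`, the output another `B * M`, and the two
coefficients `B ^ 2`. -/
lemma norm_mul_recipEstimate_sub_le (ht : t ≠ 0) {n : Fin Q → ℂ} {i : Fin N} {u k : ℂ}
    (hy₀ : ∀ m, y (m, i₀) = ∑ q, b i₀ q * v q * y (m, e q) + n m / t)
    (hy : u * y (m₀, i) = ∑ q, b i q * v q * y (m₀, e q) + k / t)
    (hdet : (frameMatrix e y).det ≠ 0) (hyi : y (m₀, i) ≠ 0) (hb₀ : ∀ q, b i₀ q ≠ 0)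
    {B M : ℝ} (hB : 1 ≤ B) (hM : 1 ≤ M) (hbB : ∀ q, ‖b i q‖ ≤ B) (hbB₀ : ∀ q, ‖(b i₀ q)⁻¹‖ ≤ B)
    (hyB : ∀ p, ‖y p‖ ≤ B * M) (hn : ∀ m, ‖n m‖ ≤ B * M) (hk : ‖k‖ ≤ B * M) :
    ‖t * (recipEstimate i₀ e b m₀ y i - u)‖
      ≤ (Q * Q.factorial * B ^ (Q + 3) + B) * M ^ (Q + 1)
        * (1 + ‖(frameMatrix e y).det‖⁻¹) * ‖y (m₀, i)‖⁻¹ := by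
  rw [mul_recipEstimate_sub ht hy hyi, norm_mul, norm_inv]
  refine mul_le_mul_of_nonneg_right ?_ (by positivity)
  have hfr : ∀ q, ‖t * (frameEstimate i₀ e b y q - v q)‖
      ≤ Q.factorial * (B * M) ^ Q * ‖(frameMatrix e y).det‖⁻¹ * B := by
    intro q
    rw [mul_frameEstimate_sub ht hy₀ hdet (hb₀ q), norm_mul, norm_div, div_eq_mul_inv]
    refine mul_le_mul (mul_le_mul_of_nonneg_right ?_ (by positivity)) (hbB₀ q) (by positivity)
      (by positivity)
    have := Matrix.det_le (A := (frameMatrix e y).updateRow q n)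
      (abv := NormedField.toAbsoluteValue ℂ) (x := B * M) (fun p j => by
        change ‖(frameMatrix e y).updateRow q n p j‖ ≤ _
        by_cases hi : p = q
        · subst hi; simpa using hn j
        · simpa [hi, frameMatrix] using hyB _)
    rw [nsmul_eq_mul, Fintype.card_fin] at this
    exact this
  have hBM : 1 ≤ B * M := one_le_mul_of_one_le_of_one_le hB hM
  set d := ‖(frameMatrix e y).det‖⁻¹
  have hd : 0 ≤ d := by positivity
  have hM0 : M ≤ M ^ (Q + 1) := le_self_pow₀ hM (by omega)
  calc _ ≤ ∑ q : Fin Q, ‖b i q * (t * (frameEstimate i₀ e b y q - v q)) * y (m₀, e q)‖ + ‖k‖ :=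
        (norm_sub_le _ _).trans (add_le_add_left (norm_sum_le _ _) _)
    _ ≤ ∑ q : Fin Q, B * (Q.factorial * (B * M) ^ Q * d * B) * (B * M) + B * M := by
        refine add_le_add (Finset.sum_le_sum fun q _ => ?_) hk
        rw [norm_mul, norm_mul]
        gcongr
        exacts [hbB q, hfr q, hyB _]
    _ = Q * Q.factorial * B ^ (Q + 3) * M ^ (Q + 1) * d + B * M := by
        rw [Finset.sum_const, Finset.card_univ, Fintype.card_fin, nsmul_eq_mul]
        ring
    _ ≤ Q * Q.factorial * B ^ (Q + 3) * M ^ (Q + 1) * (1 + d) + B * M ^ (Q + 1) * (1 + d) := by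
        refine add_le_add (by gcongr; linarith) ?_
        calc B * M ≤ B * M ^ (Q + 1) := by gcongr
          _ ≤ _ := le_mul_of_one_le_right (by positivity) (by linarith)
    _ = _ := by ring

end Estimate

/-- The logarithm turns a product into a sum of terms of finite mean, so no joint moment of `M`, `d`
and `g` is needed. -/
lemma log_one_add_mul_le {C M d g : ℝ} (hC : 0 ≤ C) (hM : 1 ≤ M) (hd : 0 ≤ d) (hg : 0 ≤ g)
    (n : ℕ) :
    Real.log (1 + C * M ^ n * (1 + d) * g) ≤ (C + n) * M + d + g := by
  have hMn : 1 ≤ M ^ n := one_le_pow₀ hM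
  calc Real.log (1 + C * M ^ n * (1 + d) * g)
      ≤ Real.log ((1 + C) * M ^ n * (1 + d) * (1 + g)) := by
        refine Real.log_le_log (by positivity) ?_
        have h1 : 1 ≤ M ^ n * (1 + d) := one_le_mul_of_one_le_of_one_le hMn (by linarith)
        have h2 : 0 ≤ C * (M ^ n * (1 + d)) := by positivity
        nlinarith [mul_nonneg (sub_nonneg.2 h1) hg]
    _ = Real.log (1 + C) + n * Real.log M + Real.log (1 + d) + Real.log (1 + g) := by
        rw [Real.log_mul (by positivity) (by positivity),
          Real.log_mul (by positivity) (by positivity),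
          Real.log_mul (by positivity) (by positivity), Real.log_pow]
    _ ≤ C + n * M + d + g := by
        have h1 := Real.log_le_sub_one_of_pos (show 0 < 1 + C by positivity)
        have h2 := Real.log_le_sub_one_of_pos (show 0 < M by positivity)
        have h3 := Real.log_le_sub_one_of_pos (show 0 < 1 + d by positivity)
        have h4 := Real.log_le_sub_one_of_pos (show 0 < 1 + g by positivity)
        have : (n : ℝ) * Real.log M ≤ n * M := by gcongr; linarith
        linarith
    _ ≤ (C + n) * M + d + g := by nlinarith

/-! ### Pointwise bound on the logarithmic error -/

/-- The channel output divided by the square root of the signal-to-noise ratio `t ^ 2`. -/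
noncomputable def scaledOutput (P : Matrix (Fin N) (Fin Q) ℂ) (t : ℝ) (x : Fin N → ℂ)
    (s : Fin Q × Fin Q → ℂ) (w : Fin Q × Fin N → ℂ) : Fin Q × Fin N → ℂ :=
  fun p => x p.2 * ∑ j, P p.2 j * s (p.1, j) + w p / t

lemma inv_smul_channelOutput (P : Matrix (Fin N) (Fin Q) ℂ) {t : ℝ} (ht : 0 < t)
    (x : Fin N → ℂ) (s : Fin Q × Fin Q → ℂ) (w : Fin Q × Fin N → ℂ) :
    ((t : ℂ))⁻¹ • channelOutput P Q (t ^ 2) x s w = scaledOutput P t x s w := by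
  ext ⟨m, i⟩
  have ht' : (t : ℂ) ≠ 0 := by exact_mod_cast ht.ne'
  have : Matrix.mulVec ((1 : Matrix (Fin Q) (Fin Q) ℂ) ⊗ₖ (Matrix.diagonal x * P)) s (m, i)
      = x i * ∑ j, P i j * s (m, j) := by
    simp [Matrix.mulVec, dotProduct, Fintype.sum_prod_type, Matrix.one_apply, Finset.mul_sum,
      mul_assoc]
  rw [channelOutput, Real.sqrt_sq ht.le, smul_add, smul_smul, inv_mul_cancel₀ ht', one_smul,
    Pi.add_apply, this]
  simp [scaledOutput, div_eq_inv_mul]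

/-- Multiplying by the reciprocal removes the input symbol; what remains is a row of `P` applied to
the fading, which `b` expands in the frame. The fading is thereby eliminated, leaving an equation
linear in `u`. -/
lemma recip_mul_scaledOutput {P : Matrix (Fin N) (Fin Q) ℂ} {e : Fin Q → Fin N}
    {b : Matrix (Fin N) (Fin Q) ℂ} (hb : b * P.submatrix e id = P) (t : ℝ) {x u : Fin N → ℂ}
    (hxu : ∀ i, u i * x i = 1) (s : Fin Q × Fin Q → ℂ) (w : Fin Q × Fin N → ℂ) (m : Fin Q)
    (i : Fin N) :
    u i * scaledOutput P t x s w (m, i)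
      = ∑ q, b i q * u (e q) * scaledOutput P t x s w (m, e q)
        + (u i * w (m, i) - ∑ q, b i q * u (e q) * w (m, e q)) / t := by
  have h : ∀ j, P i j = ∑ q, b i q * P (e q) j := fun j => by
    conv_lhs => rw [← hb]
    simp [Matrix.mul_apply]
  have h1 : ∑ q, b i q * u (e q) * scaledOutput P t x s w (m, e q)
      = ∑ j, P i j * s (m, j) + (∑ q, b i q * u (e q) * w (m, e q)) / t := by
    simp only [scaledOutput, mul_add, Finset.sum_add_distrib]
    congr 1
    · simp_rw [h, Finset.sum_mul]
      rw [Finset.sum_comm]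
      refine Finset.sum_congr rfl fun q _ => ?_
      rw [← mul_assoc, mul_assoc (b i q), hxu, mul_one, Finset.mul_sum]
      simp [mul_assoc]
    · rw [Finset.sum_div]
      refine Finset.sum_congr rfl fun q _ => ?_
      ring
  rw [h1, scaledOutput]
  simp only [mul_add, ← mul_assoc, hxu, one_mul]
  ring

/-- One plus the sum of the absolute values of all fading and noise coefficients. -/
noncomputable def totalNorm (s : Fin Q × Fin Q → ℂ) (w : Fin Q × Fin N → ℂ) : ℝ :=
  1 + ∑ p, ‖s p‖ + ∑ p, ‖w p‖

lemma exists_log_error_le {P : Matrix (Fin N) (Fin Q) ℂ} {i₀ : Fin N} {e : Fin Q → Fin N}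
    {b : Matrix (Fin N) (Fin Q) ℂ} (hb : b * P.submatrix e id = P) (hb₀ : ∀ q, b i₀ q ≠ 0)
    (m₀ : Fin Q) :
    ∃ D : ℝ, 0 ≤ D ∧ ∀ (t : ℝ), 1 ≤ t → ∀ (x u : Fin N → ℂ), (∀ i, u i * x i = 1) →
      (∀ i, ‖x i‖ ≤ 1) → (∀ i, ‖u i‖ ≤ 3) → u i₀ = 1 → ∀ s w i,
      ENNReal.ofReal (Real.log (1 + t * ‖u i - recipEstimate i₀ e b m₀ (scaledOutput P t x s w) i‖))
        ≤ ENNReal.ofReal (D * totalNorm s w) + ‖(frameMatrix e (scaledOutput P t x s w)).det‖ₑ⁻¹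
          + ‖scaledOutput P t x s w (m₀, i)‖ₑ⁻¹ := by
  set β : ℝ := ∑ i, ∑ j, ‖P i j‖ + ∑ i, ∑ q, ‖b i q‖ + ∑ q, ‖(b i₀ q)⁻¹‖ with hβ
  have hP0 : 0 ≤ ∑ i, ∑ j, ‖P i j‖ := by positivity
  have hb0 : 0 ≤ ∑ i, ∑ j, ‖b i j‖ := by positivity
  have hi0 : 0 ≤ ∑ q, ‖(b i₀ q)⁻¹‖ := by positivity
  have hβ0 : 0 ≤ β := by positivity
  have hPβ : ∀ i j, ‖P i j‖ ≤ β := fun i j => by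
    have h1 := Finset.single_le_sum (f := fun j => ‖P i j‖) (fun _ _ => norm_nonneg _)
      (Finset.mem_univ j)
    have h2 := Finset.single_le_sum (f := fun i => ∑ j, ‖P i j‖) (fun _ _ => by positivity)
      (Finset.mem_univ i)
    linarith
  have hbβ : ∀ i j, ‖b i j‖ ≤ β := fun i j => by
    have h1 := Finset.single_le_sum (f := fun j => ‖b i j‖) (fun _ _ => norm_nonneg _)
      (Finset.mem_univ j)
    have h2 := Finset.single_le_sum (f := fun i => ∑ j, ‖b i j‖) (fun _ _ => by positivity)
      (Finset.mem_univ i)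
    linarith
  have hiβ : ∀ q, ‖(b i₀ q)⁻¹‖ ≤ β := fun q => by
    have h1 := Finset.single_le_sum (f := fun q => ‖(b i₀ q)⁻¹‖) (fun _ _ => norm_nonneg _)
      (Finset.mem_univ q)
    linarith
  -- Large enough for the combined noise, at most `(3 + 3 * β * Q) * M` because `‖u i‖ ≤ 3`, and for
  -- every coefficient, at most `β`.
  set B : ℝ := 3 + β * (1 + 3 * Q) with hB
  have hβB : β ≤ B := by rw [hB]; nlinarith [mul_nonneg hβ0 (Nat.cast_nonneg (α := ℝ) Q)]
  have hB1 : 1 ≤ B := by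
    have : 0 ≤ β * (1 + 3 * Q) := by positivity
    linarith
  refine ⟨Q * Q.factorial * B ^ (Q + 3) + B + (Q + 1 : ℕ), by positivity, ?_⟩
  intro t ht x u hxu hx hu hu₀ s w i
  set y := scaledOutput P t x s w with hy
  -- A vanishing denominator makes its inverse infinite on the right, so the bound is trivial there.
  by_cases hdet : (frameMatrix e y).det = 0
  · simp [hdet]
  by_cases hyi : y (m₀, i) = 0
  · simp [hyi]
  have hs0 : 0 ≤ ∑ p, ‖s p‖ := by positivity
  have hw0 : 0 ≤ ∑ p, ‖w p‖ := by positivity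
  have hM1 : 1 ≤ totalNorm s w := by rw [totalNorm]; linarith
  have hwM : ∀ p, ‖w p‖ ≤ totalNorm s w := fun p => by
    have := Finset.single_le_sum (f := fun p => ‖w p‖) (fun _ _ => norm_nonneg _)
      (Finset.mem_univ p)
    rw [totalNorm]; linarith
  have hsw : ∀ m p, ∑ j, ‖s (m, j)‖ + ‖w p‖ ≤ totalNorm s w := fun m p => by
    have h1 := Finset.single_le_sum (f := fun p => ‖w p‖) (fun _ _ => norm_nonneg _)
      (Finset.mem_univ p)
    have h2 := Finset.single_le_sum (f := fun m => ∑ j, ‖s (m, j)‖) (fun _ _ => by positivity)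
      (Finset.mem_univ m)
    rw [totalNorm, Fintype.sum_prod_type (f := fun p => ‖s p‖)]
    linarith
  set M := totalNorm s w
  have hM0 : 0 ≤ M := by linarith
  have ht0 : (t : ℂ) ≠ 0 := by exact_mod_cast (by linarith : t ≠ 0)
  have hyB : ∀ p, ‖y p‖ ≤ B * M := by
    rintro ⟨m, k⟩
    have hs' : ‖∑ j, P k j * s (m, j)‖ ≤ β * ∑ j, ‖s (m, j)‖ := by
      refine (norm_sum_le _ _).trans ?_
      rw [Finset.mul_sum]
      refine Finset.sum_le_sum fun j _ => ?_
      rw [norm_mul]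
      exact mul_le_mul_of_nonneg_right (hPβ k j) (norm_nonneg _)
    have hw' : ‖w (m, k) / (t : ℂ)‖ ≤ ‖w (m, k)‖ := by
      rw [norm_div, Complex.norm_real, Real.norm_of_nonneg (by linarith)]
      exact div_le_self (norm_nonneg _) ht
    have hx' : ‖x k * ∑ j, P k j * s (m, j)‖ ≤ β * ∑ j, ‖s (m, j)‖ := by
      rw [norm_mul]
      exact (mul_le_of_le_one_left (norm_nonneg _) (hx k)).trans hs'
    have hsw' := hsw m (m, k)
    have hsum : 0 ≤ ∑ j, ‖s (m, j)‖ := by positivity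
    calc ‖y (m, k)‖ ≤ β * ∑ j, ‖s (m, j)‖ + ‖w (m, k)‖ :=
          (norm_add_le _ _).trans (add_le_add hx' hw')
      _ ≤ B * ∑ j, ‖s (m, j)‖ + B * ‖w (m, k)‖ := by
          gcongr
          exact le_mul_of_one_le_left (norm_nonneg _) hB1
      _ = B * (∑ j, ‖s (m, j)‖ + ‖w (m, k)‖) := by ring
      _ ≤ B * M := by gcongr
  have hnB : ∀ m k, ‖u k * w (m, k) - ∑ q, b k q * u (e q) * w (m, e q)‖ ≤ B * M := by
    intro m k
    have h1 : ‖u k * w (m, k)‖ ≤ 3 * M := by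
      rw [norm_mul]
      exact mul_le_mul (hu k) (hwM _) (norm_nonneg _) (by norm_num)
    have h2 : ‖∑ q, b k q * u (e q) * w (m, e q)‖ ≤ ∑ q : Fin Q, β * 3 * M := by
      refine (norm_sum_le _ _).trans (Finset.sum_le_sum fun q _ => ?_)
      rw [norm_mul, norm_mul]
      gcongr
      exacts [hbβ k q, hu _, hwM _]
    rw [Finset.sum_const, Finset.card_univ, Fintype.card_fin, nsmul_eq_mul] at h2
    refine (norm_sub_le _ _).trans ((add_le_add h1 h2).trans ?_)
    rw [hB]
    nlinarith [mul_nonneg hβ0 hM0]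
  have hrec := recip_mul_scaledOutput hb t hxu s w
  have hmain := norm_mul_recipEstimate_sub_le (i₀ := i₀) (e := e) (b := b) (m₀ := m₀) (y := y)
    (v := fun q => u (e q)) ht0
    (fun m => by
      have := hrec m i₀
      rw [hu₀, one_mul] at this
      rw [hy, this])
    (hrec m₀ i) hdet hyi hb₀ hB1 hM1 (fun q => (hbβ i q).trans hβB) (fun q => (hiβ q).trans hβB)
    hyB (fun m => by simpa [hu₀] using hnB m i₀) (hnB m₀ i)
  rw [norm_mul, Complex.norm_real, Real.norm_of_nonneg (by linarith), norm_sub_rev] at hmain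
  have hCQ : 0 ≤ Q * Q.factorial * B ^ (Q + 3) + B := by positivity
  have hlog := (Real.log_le_log (by positivity) (add_le_add_right hmain 1)).trans
    (log_one_add_mul_le hCQ hM1 (by positivity) (by positivity) (Q + 1))
  rw [← ofReal_norm, ← ofReal_norm (y (m₀, i)), ← ENNReal.ofReal_inv_of_pos (norm_pos_iff.2 hdet),
    ← ENNReal.ofReal_inv_of_pos (norm_pos_iff.2 hyi), ← ENNReal.ofReal_add (by positivity)
    (by positivity), ← ENNReal.ofReal_add (by positivity) (by positivity)]
  exact ENNReal.ofReal_le_ofReal hlog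

/-! ### The input law and its small-ball bound -/

/-- The law of the reciprocal of a uniform point of the disc with centre `2` and radius `1`. -/
noncomputable def recipLaw : Measure ℂ :=
  (ProbabilityTheory.cond volume (Metric.ball (2 : ℂ) 1)).map fun z => z⁻¹

instance : IsProbabilityMeasure recipLaw := by
  have : IsProbabilityMeasure (ProbabilityTheory.cond volume (Metric.ball (2 : ℂ) 1)) :=
    cond_isProbabilityMeasure_of_finite (Metric.measure_ball_pos _ _ one_pos).ne'
      measure_ball_lt_top.ne
  exact Measure.isProbabilityMeasure_map (by fun_prop)

/-- The disc lies in the annulus `1 ≤ ‖u‖ ≤ 3`: the inner radius gives the power constraint, the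
outer one the constant 3 of the error bounds. -/
lemma ae_recipLaw : ∀ᵐ z ∂recipLaw, z⁻¹ * z = 1 ∧ ‖z‖ ≤ 1 ∧ ‖z⁻¹‖ ≤ 3 := by
  have hm : MeasurableSet {z : ℂ | z⁻¹ * z = 1 ∧ ‖z‖ ≤ 1 ∧ ‖z⁻¹‖ ≤ 3} :=
    (measurableSet_eq_fun (measurable_inv.mul measurable_id) measurable_const).inter
      ((measurableSet_le measurable_norm measurable_const).inter
        (measurableSet_le measurable_inv.norm measurable_const))
  rw [recipLaw, ae_map_iff (by fun_prop) hm]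
  filter_upwards [ae_cond_mem (μ := volume) (measurableSet_ball (x := (2 : ℂ)) (ε := 1))] with z hz
  rw [mem_ball_iff_norm] at hz
  have h1 : 1 ≤ ‖z‖ := by
    have := norm_sub_norm_le (2 : ℂ) (2 - z)
    rw [norm_sub_rev 2 z, sub_sub_cancel, Complex.norm_ofNat] at this
    linarith
  have h2 : ‖z‖ ≤ 3 := by
    have := norm_add_le (z - 2) 2
    rw [sub_add_cancel, Complex.norm_ofNat] at this
    linarith
  have h0 : z ≠ 0 := by
    rintro rfl
    simp at h1
    linarith
  refine ⟨?_, ?_, ?_⟩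
  · rw [inv_inv, mul_inv_cancel₀ h0]
  · rw [norm_inv]; exact inv_le_one_of_one_le₀ h1
  · rwa [inv_inv]

/-- A density on the reciprocals, concentrated at scale `t⁻¹` around a point, has bounded mass. -/
lemma exists_lintegral_recipLaw_le :
    ∃ J : ℝ, 0 < J ∧ ∀ t : ℝ, 0 < t → ∀ c : ℂ,
      ∫⁻ x, ENNReal.ofReal (t ^ 2 / J * ((1 + t * ‖x⁻¹ - c‖) ^ 3)⁻¹) ∂recipLaw ≤ 1 := by
  set g : ℂ → ℝ≥0∞ := fun u => ENNReal.ofReal (((1 + ‖u‖) ^ 3)⁻¹) with hg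
  have hgm : Measurable g := by fun_prop
  -- The decay exponent 3 exceeds the real dimension 2 of `ℂ`.
  have hfin : ∫⁻ u, g u < ∞ := by
    have := finite_integral_one_add_norm (E := ℂ) (μ := volume) (r := (3 : ℕ))
      (by rw [Complex.finrank_real_complex]; norm_num)
    refine lt_of_eq_of_lt (lintegral_congr fun u => ?_) this
    rw [Real.rpow_neg (by positivity), Real.rpow_natCast]
  set V : ℝ≥0∞ := volume (Metric.ball (2 : ℂ) 1)
  have hV : V ≠ 0 := (Metric.measure_ball_pos _ _ one_pos).ne'
  set J₀ := V⁻¹ * ∫⁻ u, g u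
  have hJ₀ : J₀ ≠ ∞ := ENNReal.mul_ne_top (ENNReal.inv_ne_top.2 hV) hfin.ne
  refine ⟨J₀.toReal + 1, by positivity, fun t ht c => ?_⟩
  set J := J₀.toReal + 1
  have hJ : 0 < J := by positivity
  -- Dilation by `t` in real dimension 2 yields `(t ^ 2)⁻¹`, which is why the test density may carry
  -- the weight `t ^ 2`.
  have hscale : ∫⁻ u, g (t • (u - c)) = ENNReal.ofReal ((t ^ 2)⁻¹) * ∫⁻ u, g u := by
    rw [lintegral_sub_right_eq_self (fun u => g (t • u)) c]
    have := Measure.map_addHaar_smul (volume : Measure ℂ) ht.ne'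
    rw [Complex.finrank_real_complex, abs_of_pos (by positivity)] at this
    rw [← smul_eq_mul, ← lintegral_smul_measure, ← this, lintegral_map hgm (by fun_prop)]
  calc ∫⁻ x, ENNReal.ofReal (t ^ 2 / J * ((1 + t * ‖x⁻¹ - c‖) ^ 3)⁻¹) ∂recipLaw
      = V⁻¹ * ∫⁻ u in Metric.ball 2 1, ENNReal.ofReal (t ^ 2 / J) * g (t • (u - c)) := by
        rw [recipLaw, lintegral_map (by fun_prop) (by fun_prop), ProbabilityTheory.cond,
          lintegral_smul_measure, smul_eq_mul]
        congr 1
        refine lintegral_congr fun u => ?_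
        rw [hg, ← ENNReal.ofReal_mul (by positivity), inv_inv, norm_smul,
          Real.norm_of_nonneg ht.le]
    _ ≤ V⁻¹ * ∫⁻ u, ENNReal.ofReal (t ^ 2 / J) * g (t • (u - c)) := by
        gcongr
        exact Measure.restrict_le_self
    _ = ENNReal.ofReal (t ^ 2 / J) * ENNReal.ofReal ((t ^ 2)⁻¹) * J₀ := by
        rw [lintegral_const_mul _ (by fun_prop), hscale]
        ring
    _ = ENNReal.ofReal J⁻¹ * ENNReal.ofReal J₀.toReal := by
        rw [← ENNReal.ofReal_mul (by positivity), ENNReal.ofReal_toReal hJ₀]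
        congr 2
        field_simp
    _ ≤ 1 := by
        rw [← ENNReal.ofReal_mul (by positivity), ← ENNReal.ofReal_one]
        refine ENNReal.ofReal_le_ofReal ?_
        rw [inv_mul_le_one₀ hJ]
        exact le_add_of_nonneg_right zero_le_one

/-- The law of the `i`-th input symbol: deterministic at the pilot time `i₀`. -/
noncomputable def symbolLaw (i₀ i : Fin N) : Measure ℂ :=
  if i = i₀ then Measure.dirac 1 else recipLaw

instance (i₀ i : Fin N) : IsProbabilityMeasure (symbolLaw i₀ i) := by
  unfold symbolLaw; split_ifs <;> infer_instance

/-- The input law with a pilot at time `i₀` and independent symbols at the other times. -/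
noncomputable def inputLaw (i₀ : Fin N) : Measure (Fin N → ℂ) := Measure.pi (symbolLaw i₀)

instance (i₀ : Fin N) : IsProbabilityMeasure (inputLaw i₀) := by
  unfold inputLaw; infer_instance

lemma ae_inputLaw (i₀ : Fin N) :
    ∀ᵐ x ∂inputLaw i₀, (∀ i, (x i)⁻¹ * x i = 1 ∧ ‖x i‖ ≤ 1 ∧ ‖(x i)⁻¹‖ ≤ 3) ∧ x i₀ = 1 := by
  refine Filter.Eventually.and (ae_all_iff.2 fun i => ?_) ?_
  · have h : ∀ᵐ z ∂symbolLaw i₀ i, z⁻¹ * z = 1 ∧ ‖z‖ ≤ 1 ∧ ‖z⁻¹‖ ≤ 3 := by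
      unfold symbolLaw
      split_ifs
      · rw [ae_dirac_eq]
        refine eventually_pure.2 ?_
        norm_num
      · exact ae_recipLaw
    exact (Measure.quasiMeasurePreserving_eval (symbolLaw i₀) i).ae h
  · have h : ∀ᵐ z ∂symbolLaw i₀ i₀, z = 1 := by
      rw [symbolLaw, if_pos rfl, ae_dirac_eq]
      exact eventually_pure.2 rfl
    exact (Measure.quasiMeasurePreserving_eval (symbolLaw i₀) i₀).ae h

lemma isAdmissibleInput_inputLaw (i₀ : Fin N) : IsAdmissibleInput (inputLaw i₀) := by
  refine ⟨inferInstance, ?_⟩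
  calc _ ≤ ∫⁻ _, (N : ℝ≥0∞) ∂inputLaw i₀ := by
        refine lintegral_mono_ae ?_
        filter_upwards [ae_inputLaw i₀] with x hx
        calc ∑ i, ‖x i‖ₑ ^ 2 ≤ ∑ _i : Fin N, (1 : ℝ≥0∞) := by
              refine Finset.sum_le_sum fun i _ => pow_le_one₀ zero_le ?_
              rw [← ofReal_norm, ENNReal.ofReal_le_one]
              exact (hx.1 i).2.1
          _ = N := by simp
    _ = N := by simp

/-! ### Averaging the logarithmic error -/

lemma measurable_scaledOutput (P : Matrix (Fin N) (Fin Q) ℂ) (t : ℝ) :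
    Measurable fun ω : (Fin N → ℂ) × (Fin Q × Fin Q → ℂ) × (Fin Q × Fin N → ℂ) =>
      scaledOutput P t ω.1 ω.2.1 ω.2.2 := by
  refine measurable_pi_iff.2 fun p => ?_
  unfold scaledOutput
  fun_prop

lemma measurable_det_frameMatrix (e : Fin Q → Fin N) :
    Measurable fun y : Fin Q × Fin N → ℂ => (frameMatrix e y).det := by
  simp only [Matrix.det_apply, frameMatrix, Matrix.of_apply]
  fun_prop

lemma measurable_recipEstimate (i₀ : Fin N) (e : Fin Q → Fin N) (b : Matrix (Fin N) (Fin Q) ℂ)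
    (m₀ : Fin Q) (i : Fin N) :
    Measurable fun y : Fin Q × Fin N → ℂ => recipEstimate i₀ e b m₀ y i := by
  have h1 := measurable_det_frameMatrix e
  have h2 : ∀ q, Measurable fun y : Fin Q × Fin N → ℂ =>
      ((frameMatrix e y).updateRow q fun m => y (m, i₀)).det := fun q => by
    simp only [Matrix.det_apply, frameMatrix, Matrix.updateRow_apply, Matrix.of_apply]
    refine Finset.measurable_sum _ fun σ _ => Measurable.const_smul
      (Finset.measurable_prod _ fun i _ => ?_) _
    split_ifs <;> fun_prop
  unfold recipEstimate frameEstimate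
  fun_prop

/-- With `A = diag(x ∘ e) P_e`, where `P_e` consists of the frame rows, the frame matrix is `A * (S
+ A⁻¹ * W)` with `S` Gaussian. For fixed input and noise this is a shifted Gaussian matrix, and `3 ^
Q` bounds the reciprocal of `∏ q, x (e q)`. -/
lemma lintegral_inv_enorm_det_frameMatrix_le {P : Matrix (Fin N) (Fin Q) ℂ} {e : Fin Q → Fin N}
    (hA : (P.submatrix e id).det ≠ 0) (t : ℝ) {x : Fin N → ℂ} (hx : ∀ i, (x i)⁻¹ * x i = 1)
    (hx3 : ∀ i, ‖(x i)⁻¹‖ ≤ 3) (w : Fin Q × Fin N → ℂ) :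
    ∫⁻ s, ‖(frameMatrix e (scaledOutput P t x s w)).det‖ₑ⁻¹ ∂stdComplexGaussianVec (Fin Q × Fin Q)
      ≤ ENNReal.ofReal (3 ^ Q * ‖(P.submatrix e id).det⁻¹‖) * invMoment ^ Q := by
  set A := Matrix.diagonal (fun q => x (e q)) * P.submatrix e id with hAdef
  have hx0 : ∀ i, x i ≠ 0 := fun i h => by simpa [h] using hx i
  have hAdet : A.det = (∏ q, x (e q)) * (P.submatrix e id).det := by
    rw [hAdef, Matrix.det_mul, Matrix.det_diagonal]
  have hA0 : A.det ≠ 0 := by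
    rw [hAdet]
    exact mul_ne_zero (Finset.prod_ne_zero_iff.2 fun q _ => hx0 _) hA
  set W : Matrix (Fin Q) (Fin Q) ℂ := Matrix.of fun q m => w (m, e q) / t with hW
  have hdet : ∀ s, (frameMatrix e (scaledOutput P t x s w)).det
      = A.det * ((Matrix.of fun j m => s (m, j)) + A⁻¹ * W).det := by
    intro s
    rw [← Matrix.det_mul, Matrix.mul_add, ← Matrix.mul_assoc, Matrix.mul_nonsing_inv _ hA0.isUnit,
      Matrix.one_mul]
    congr 1
    ext q m
    rw [Matrix.add_apply, Matrix.mul_apply]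
    simp only [hAdef, Matrix.diagonal_mul]
    simp [frameMatrix, scaledOutput, hW, Finset.mul_sum, mul_assoc]
  have hnorm : ‖A.det‖ₑ⁻¹ ≤ ENNReal.ofReal (3 ^ Q * ‖(P.submatrix e id).det⁻¹‖) := by
    rw [← enorm_inv hA0, ← ofReal_norm, hAdet, mul_inv, norm_mul, ← Finset.prod_inv_distrib,
      norm_prod]
    refine ENNReal.ofReal_le_ofReal (mul_le_mul_of_nonneg_right ?_ (norm_nonneg _))
    refine (Finset.prod_le_prod (fun _ _ => norm_nonneg _) fun q _ => hx3 (e q)).trans ?_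
    simp
  have h := lintegral_inv_enorm_det_add_le (ι := Fin Q × Fin Q) (fun j m => (m, j))
    (fun p q hpq => by
      simp only [Function.uncurry, Prod.mk.injEq] at hpq
      exact Prod.ext hpq.2 hpq.1) (A⁻¹ * W)
  calc _ = ∫⁻ s, ‖A.det‖ₑ⁻¹ * ‖((Matrix.of fun j m => s (m, j)) + A⁻¹ * W).det‖ₑ⁻¹
        ∂stdComplexGaussianVec (Fin Q × Fin Q) := by
        refine lintegral_congr fun s => ?_
        rw [hdet, enorm_mul, ENNReal.mul_inv (by simp) (by simp)]
    _ = ‖A.det‖ₑ⁻¹ * ∫⁻ s, ‖((Matrix.of fun j m => s (m, j)) + A⁻¹ * W).det‖ₑ⁻¹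
        ∂stdComplexGaussianVec (Fin Q × Fin Q) :=
        lintegral_const_mul' _ _ (ENNReal.inv_ne_top.2 (by simpa using hA0))
    _ ≤ _ := mul_le_mul' hnorm h

/-- The output is affine in the single fading variable `s (m, j)`, with slope `x i * P i j`. -/
lemma lintegral_inv_enorm_scaledOutput_le (P : Matrix (Fin N) (Fin Q) ℂ) {i : Fin N} {j : Fin Q}
    (hP : P i j ≠ 0) (t : ℝ) {x : Fin N → ℂ} (hx : (x i)⁻¹ * x i = 1) (hx3 : ‖(x i)⁻¹‖ ≤ 3)
    (m : Fin Q) (w : Fin Q × Fin N → ℂ) :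
    ∫⁻ s, ‖scaledOutput P t x s w (m, i)‖ₑ⁻¹ ∂stdComplexGaussianVec (Fin Q × Fin Q)
      ≤ invMoment * ENNReal.ofReal (3 * ‖(P i j)⁻¹‖) := by
  have hx0 : x i ≠ 0 := fun h => by simp [h] at hx
  have h := lintegral_inv_enorm_dotProduct_le (ι := Fin Q × Fin Q)
    (fun p => if p.1 = m then x i * P i p.2 else 0) (w (m, i) / t) (m, j)
  simp only [if_true] at h
  refine le_trans (le_of_eq (lintegral_congr fun s => ?_)) (h.trans (mul_le_mul_right ?_ _))
  · rw [Fintype.sum_prod_type, Finset.sum_comm]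
    simp [scaledOutput, ite_mul, Finset.mul_sum, mul_assoc]
  · rw [← enorm_inv (mul_ne_zero hx0 hP), ← ofReal_norm, mul_inv, norm_mul]
    exact ENNReal.ofReal_le_ofReal (mul_le_mul_of_nonneg_right hx3 (norm_nonneg _))

lemma lintegral_totalNorm_ne_top :
    ∫⁻ p, ENNReal.ofReal (totalNorm p.1 p.2) ∂((stdComplexGaussianVec (Fin Q × Fin Q)).prod
      (stdComplexGaussianVec (Fin Q × Fin N))) ≠ ∞ := by
  have heval : ∀ {ι : Type} [Fintype ι] (j : ι),
      ∫⁻ s, ‖s j‖ₑ ∂stdComplexGaussianVec ι ≠ ∞ := fun {ι} _ j => by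
    rw [stdComplexGaussianVec, (measurePreserving_eval (fun _ : ι => stdComplexGaussian)
      j).lintegral_comp (f := fun z => ‖z‖ₑ) (by fun_prop)]
    exact lintegral_enorm_stdComplexGaussian_ne_top
  have hsplit : ∀ p : (Fin Q × Fin Q → ℂ) × (Fin Q × Fin N → ℂ),
      ENNReal.ofReal (totalNorm p.1 p.2) = 1 + ∑ j, ‖p.1 j‖ₑ + ∑ j, ‖p.2 j‖ₑ := fun p => by
    rw [totalNorm, ENNReal.ofReal_add (by positivity) (by positivity),
      ENNReal.ofReal_add (by positivity) (by positivity), ENNReal.ofReal_one,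
      ENNReal.ofReal_sum_of_nonneg (fun _ _ => norm_nonneg _),
      ENNReal.ofReal_sum_of_nonneg (fun _ _ => norm_nonneg _)]
    simp only [ofReal_norm]
  simp_rw [hsplit]
  rw [lintegral_add_right _ (by fun_prop), lintegral_add_right _ (by fun_prop),
    lintegral_finsetSum _ (by fun_prop), lintegral_finsetSum _ (by fun_prop)]
  refine ENNReal.add_ne_top.2 ⟨ENNReal.add_ne_top.2 ⟨by simp, ?_⟩, ?_⟩
  · refine ENNReal.sum_ne_top.2 fun j _ => ?_
    rw [measurePreserving_fst.lintegral_comp (f := fun s : Fin Q × Fin Q → ℂ => ‖s j‖ₑ)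
      (by fun_prop)]
    exact heval j
  · refine ENNReal.sum_ne_top.2 fun j _ => ?_
    rw [measurePreserving_snd.lintegral_comp (f := fun s : Fin Q × Fin N → ℂ => ‖s j‖ₑ)
      (by fun_prop)]
    exact heval j

instance {R : ℕ} (μ : Measure (Fin N → ℂ)) [IsProbabilityMeasure μ] :
    IsProbabilityMeasure (blockLaw Q R μ) := by
  unfold blockLaw; infer_instance

/-- An integral over the block law is bounded by a bound, uniform in the noise and in almost
every input, on the integral over the fading. -/
lemma lintegral_blockLaw_le {μ : Measure (Fin N → ℂ)} [IsProbabilityMeasure μ]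
    {F : (Fin N → ℂ) × (Fin Q × Fin Q → ℂ) × (Fin Q × Fin N → ℂ) → ℝ≥0∞} (hF : Measurable F)
    {K : ℝ≥0∞}
    (h : ∀ᵐ x ∂μ, ∀ w, ∫⁻ s, F (x, s, w) ∂stdComplexGaussianVec (Fin Q × Fin Q) ≤ K) :
    ∫⁻ ω, F ω ∂blockLaw Q Q μ ≤ K := by
  rw [blockLaw, lintegral_prod _ hF.aemeasurable]
  calc _ ≤ ∫⁻ _, K ∂μ := by
        refine lintegral_mono_ae ?_
        filter_upwards [h] with x hx
        rw [lintegral_prod_symm' _ (by fun_prop)]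
        exact (lintegral_mono hx).trans (by simp)
    _ = K := by simp

/-- The mean logarithmic error of the estimate of the reciprocals of the input symbols, measured
at scale `t⁻¹`, is bounded uniformly in `t ≥ 1`. -/
lemma exists_lintegral_log_error_le {P : Matrix (Fin N) (Fin Q) ℂ} (hrow : ∀ i, P.row i ≠ 0)
    {i₀ : Fin N} {e : Fin Q → Fin N} {b : Matrix (Fin N) (Fin Q) ℂ}
    (hA : (P.submatrix e id).det ≠ 0) (hb : b * P.submatrix e id = P) (hb₀ : ∀ q, b i₀ q ≠ 0)
    (m₀ : Fin Q) (i : Fin N) :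
    ∃ K : ℝ≥0∞, K ≠ ∞ ∧ ∀ t : ℝ, 1 ≤ t →
      ∫⁻ ω, ENNReal.ofReal (Real.log (1 + t * ‖(ω.1 i)⁻¹ - recipEstimate i₀ e b m₀
        (scaledOutput P t ω.1 ω.2.1 ω.2.2) i‖)) ∂blockLaw Q Q (inputLaw i₀) ≤ K := by
  obtain ⟨D, hD, hlog⟩ := exists_log_error_le hb hb₀ m₀
  -- A nonzero entry in row `i` keeps the divisor `y (m₀, i)` nondegenerate.
  obtain ⟨j, hj⟩ := Function.ne_iff.1 (hrow i)
  refine ⟨ENNReal.ofReal D * ∫⁻ p, ENNReal.ofReal (totalNorm p.1 p.2)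
      ∂((stdComplexGaussianVec (Fin Q × Fin Q)).prod (stdComplexGaussianVec (Fin Q × Fin N)))
    + ENNReal.ofReal (3 ^ Q * ‖(P.submatrix e id).det⁻¹‖) * invMoment ^ Q
    + invMoment * ENNReal.ofReal (3 * ‖(P i j)⁻¹‖), ?_, fun t ht => ?_⟩
  · have h1 := lintegral_totalNorm_ne_top (N := N) (Q := Q)
    have h2 := invMoment_ne_top
    finiteness
  have hsm := measurable_scaledOutput P t
  have hdm : Measurable fun ω : (Fin N → ℂ) × (Fin Q × Fin Q → ℂ) × (Fin Q × Fin N → ℂ) =>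
      ‖(frameMatrix e (scaledOutput P t ω.1 ω.2.1 ω.2.2)).det‖ₑ⁻¹ :=
    ((measurable_det_frameMatrix e).comp hsm).enorm.inv
  have hym : Measurable fun ω : (Fin N → ℂ) × (Fin Q × Fin Q → ℂ) × (Fin Q × Fin N → ℂ) =>
      ‖scaledOutput P t ω.1 ω.2.1 ω.2.2 (m₀, i)‖ₑ⁻¹ :=
    ((measurable_pi_apply (m₀, i)).comp hsm).enorm.inv
  have hmT : Measurable fun p : (Fin Q × Fin Q → ℂ) × (Fin Q × Fin N → ℂ) =>
      ENNReal.ofReal (totalNorm p.1 p.2) := by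
    unfold totalNorm; fun_prop
  calc _ ≤ ∫⁻ ω, (ENNReal.ofReal D * ENNReal.ofReal (totalNorm ω.2.1 ω.2.2)
        + ‖(frameMatrix e (scaledOutput P t ω.1 ω.2.1 ω.2.2)).det‖ₑ⁻¹
        + ‖scaledOutput P t ω.1 ω.2.1 ω.2.2 (m₀, i)‖ₑ⁻¹) ∂blockLaw Q Q (inputLaw i₀) := by
        refine lintegral_mono_ae ?_
        have hae : ∀ᵐ ω ∂blockLaw Q Q (inputLaw i₀),
            (∀ i, (ω.1 i)⁻¹ * ω.1 i = 1 ∧ ‖ω.1 i‖ ≤ 1 ∧ ‖(ω.1 i)⁻¹‖ ≤ 3) ∧ ω.1 i₀ = 1 :=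
          Measure.quasiMeasurePreserving_fst.ae (ae_inputLaw i₀)
        filter_upwards [hae] with ω hω
        rw [← ENNReal.ofReal_mul hD]
        exact hlog t ht ω.1 (fun i => (ω.1 i)⁻¹) (fun i => (hω.1 i).1) (fun i => (hω.1 i).2.1)
          (fun i => (hω.1 i).2.2) (by simp [hω.2]) ω.2.1 ω.2.2 i
    _ = ENNReal.ofReal D * ∫⁻ ω, ENNReal.ofReal (totalNorm ω.2.1 ω.2.2)
          ∂blockLaw Q Q (inputLaw i₀)
        + ∫⁻ ω, ‖(frameMatrix e (scaledOutput P t ω.1 ω.2.1 ω.2.2)).det‖ₑ⁻¹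
          ∂blockLaw Q Q (inputLaw i₀)
        + ∫⁻ ω, ‖scaledOutput P t ω.1 ω.2.1 ω.2.2 (m₀, i)‖ₑ⁻¹ ∂blockLaw Q Q (inputLaw i₀) := by
        rw [lintegral_add_right _ hym, lintegral_add_right _ hdm,
          lintegral_const_mul' _ _ ENNReal.ofReal_ne_top]
    _ ≤ _ := by
        refine add_le_add (add_le_add (mul_le_mul_right (le_of_eq ?_) _) ?_) ?_
        · exact measurePreserving_snd.lintegral_comp hmT
        · refine lintegral_blockLaw_le hdm ?_
          filter_upwards [ae_inputLaw i₀] with x hx w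
          exact lintegral_inv_enorm_det_frameMatrix_le hA t (fun i => (hx.1 i).1)
            (fun i => (hx.1 i).2.2) w
        · refine lintegral_blockLaw_le hym ?_
          filter_upwards [ae_inputLaw i₀] with x hx w
          exact lintegral_inv_enorm_scaledOutput_le P hj t (hx.1 i).1 (hx.1 i).2.2 m₀ w

/-! ### From the error bound to mutual information and capacity -/

lemma measurable_channelOutput (P : Matrix (Fin N) (Fin Q) ℂ) (snr : ℝ) :
    Measurable fun ω : (Fin N → ℂ) × (Fin Q × Fin Q → ℂ) × (Fin Q × Fin N → ℂ) =>
      channelOutput P Q snr ω.1 ω.2.1 ω.2.2 := by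
  refine measurable_pi_iff.2 fun p => ?_
  simp only [channelOutput, Matrix.mulVec, dotProduct, Pi.add_apply, Pi.smul_apply,
    Matrix.kroneckerMap_apply, Matrix.diagonal_mul]
  fun_prop

lemma exp_log_sub_three_mul_log {a d : ℝ} (ha : 0 < a) (hd : 0 < d) :
    Real.exp (Real.log a - 3 * Real.log d) = a * (d ^ 3)⁻¹ := by
  have : 3 * Real.log d = Real.log (d ^ 3) := by rw [Real.log_pow]; norm_num
  rw [this, Real.exp_sub, Real.exp_log ha, Real.exp_log (by positivity), div_eq_mul_inv]

/-- If functions `T i` of the output estimate the reciprocals of the input symbols at scale `t⁻¹`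
up to a bounded mean logarithmic error, the mutual information grows like
`(N - 1) * log (t ^ 2)`. -/
lemma exists_le_klDiv_of_log_error_le {P : Matrix (Fin N) (Fin Q) ℂ} {i₀ : Fin N}
    {T : Fin N → (Fin Q × Fin N → ℂ) → ℂ} (hT : ∀ i, Measurable (T i)) {K : Fin N → ℝ≥0∞}
    (hK : ∀ i, K i ≠ ∞)
    (herr : ∀ i, ∀ t : ℝ, 1 ≤ t → ∫⁻ ω, ENNReal.ofReal (Real.log (1 + t * ‖(ω.1 i)⁻¹
        - T i (scaledOutput P t ω.1 ω.2.1 ω.2.2)‖)) ∂blockLaw Q Q (inputLaw i₀) ≤ K i) :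
    ∃ C : ℝ, ∀ t : ℝ, 1 ≤ t →
      ENNReal.ofReal (((N : ℝ) - 1) * Real.log (t ^ 2) - C) ≤ InformationTheory.klDiv
        ((blockLaw Q Q (inputLaw i₀)).map fun ω =>
          (ω.1, channelOutput P Q (t ^ 2) ω.1 ω.2.1 ω.2.2))
        (((blockLaw Q Q (inputLaw i₀)).map fun ω => ω.1).prod
          ((blockLaw Q Q (inputLaw i₀)).map fun ω => channelOutput P Q (t ^ 2) ω.1 ω.2.1 ω.2.2)) := by
  obtain ⟨J, hJ, hJle⟩ := exists_lintegral_recipLaw_le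
  set K₀ : ℝ≥0∞ := ∑ i ∈ Finset.univ.erase i₀, ENNReal.ofReal 3 * K i with hK₀
  have hK₀' : K₀ ≠ ∞ :=
    ENNReal.sum_ne_top.2 fun i _ => ENNReal.mul_ne_top ENNReal.ofReal_ne_top (hK i)
  refine ⟨((N : ℝ) - 1) * Real.log J + K₀.toReal, fun t ht => ?_⟩
  have ht0 : 0 < t := by linarith
  set μ := blockLaw Q Q (inputLaw i₀)
  have hY := measurable_channelOutput P (t ^ 2)
  have hX : μ.map (fun ω => ω.1) = inputLaw i₀ := measurePreserving_fst.map_eq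
  have hYp : IsProbabilityMeasure (μ.map fun ω => channelOutput P Q (t ^ 2) ω.1 ω.2.1 ω.2.2) :=
    Measure.isProbabilityMeasure_map hY.aemeasurable
  have hXYm : Measurable fun ω : (Fin N → ℂ) × (Fin Q × Fin Q → ℂ) × (Fin Q × Fin N → ℂ) =>
      (ω.1, channelOutput P Q (t ^ 2) ω.1 ω.2.1 ω.2.2) := measurable_fst.prodMk hY
  have hXYp : IsProbabilityMeasure (μ.map fun ω =>
      (ω.1, channelOutput P Q (t ^ 2) ω.1 ω.2.1 ω.2.2)) :=
    Measure.isProbabilityMeasure_map hXYm.aemeasurable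
  rw [hX]
  set c : ℝ := ∑ _i ∈ Finset.univ.erase i₀, Real.log (t ^ 2 / J) with hc
  have hcN : c = ((N : ℝ) - 1) * (Real.log (t ^ 2) - Real.log J) := by
    rw [hc, Finset.sum_const, Finset.card_erase_of_mem (Finset.mem_univ _), Finset.card_univ,
      Fintype.card_fin, nsmul_eq_mul, Nat.cast_sub (by have := i₀.pos; omega), Nat.cast_one,
      Real.log_div (by positivity) hJ.ne']
  have hgoal : ((N : ℝ) - 1) * Real.log (t ^ 2) - (((N : ℝ) - 1) * Real.log J + K₀.toReal)
      = c - K₀.toReal := by rw [hcN]; ring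
  rw [hgoal]
  -- For `c ≤ 0` the truncation in `ENNReal.ofReal` makes the claim trivial; the variational bound
  -- requires `0 ≤ c`.
  rcases le_or_gt c 0 with hc0 | hc0
  · rw [ENNReal.ofReal_of_nonpos (by linarith [ENNReal.toReal_nonneg (a := K₀)])]
    exact zero_le
  rw [ENNReal.ofReal_sub _ ENNReal.toReal_nonneg, ENNReal.ofReal_toReal hK₀', tsub_le_iff_right]
  let ℓ : Fin N → (Fin N → ℂ) → (Fin Q × Fin N → ℂ) → ℝ := fun i x y =>
    1 + t * ‖(x i)⁻¹ - T i ((t : ℂ)⁻¹ • y)‖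
  have hℓ1 : ∀ i x y, 1 ≤ ℓ i x y := fun i x y => by
    have : 0 ≤ t * ‖(x i)⁻¹ - T i ((t : ℂ)⁻¹ • y)‖ := by positivity
    simp only [ℓ]; linarith
  have hℓm : ∀ i, Measurable fun p : (Fin N → ℂ) × (Fin Q × Fin N → ℂ) => ℓ i p.1 p.2 :=
    fun i => by
      have := hT i
      simp only [ℓ]
      fun_prop
  let L : (Fin N → ℂ) × (Fin Q × Fin N → ℂ) → ℝ := fun p =>
    ∑ i ∈ Finset.univ.erase i₀, 3 * Real.log (ℓ i p.1 p.2)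
  have hLm : Measurable L := by
    have := hℓm
    simp only [L]
    fun_prop
  have hL0 : ∀ p, 0 ≤ L p := fun p =>
    Finset.sum_nonneg fun i _ => mul_nonneg (by norm_num) (Real.log_nonneg (hℓ1 i _ _))
  refine (ofReal_le_klDiv_add _ _ hc0.le hL0 hLm ?_).trans (add_le_add_right ?_ _)
  · have hpt : ∀ x y, ENNReal.ofReal (Real.exp (c - L (x, y))) = ∏ i, (if i = i₀ then 1 else
        ENNReal.ofReal (t ^ 2 / J
          * ((1 + t * ‖(x i)⁻¹ - T i ((t : ℂ)⁻¹ • y)‖) ^ 3)⁻¹)) := by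
      intro x y
      rw [← Finset.mul_prod_erase _ _ (Finset.mem_univ i₀), if_pos rfl, one_mul, hc,
        ← Finset.sum_sub_distrib, Real.exp_sum,
        ENNReal.ofReal_prod_of_nonneg fun _ _ => Real.exp_nonneg _]
      refine Finset.prod_congr rfl fun i hi => ?_
      rw [if_neg (Finset.ne_of_mem_erase hi), exp_log_sub_three_mul_log (by positivity)
        (zero_lt_one.trans_le (hℓ1 i _ _))]
    -- Under the product law, fixing `y` turns the estimates into constants independent of `x`; each
    -- symbol then contributes at most 1, and the pilot exactly 1.
    rw [lintegral_prod_symm' _ (by fun_prop)]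
    refine (lintegral_mono (g := fun _ => 1) fun y => ?_).trans (by simp)
    have hF : ∀ i, Measurable fun z : ℂ => if i = i₀ then (1 : ℝ≥0∞) else
        ENNReal.ofReal (t ^ 2 / J * ((1 + t * ‖z⁻¹ - T i ((t : ℂ)⁻¹ • y)‖) ^ 3)⁻¹) := fun i => by
      generalize T i ((t : ℂ)⁻¹ • y) = a
      split_ifs <;> fun_prop
    refine ((lintegral_congr fun x => hpt x y).trans
      (lintegral_pi_prod_eq_prod_lintegral (symbolLaw i₀) hF)).trans_le ?_
    refine Finset.prod_le_one' fun i _ => ?_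
    by_cases hi : i = i₀
    · simp [hi]
    · simp only [symbolLaw, if_neg hi]
      exact hJle t ht0 _
  -- Under the joint law the estimates are close to the true reciprocals, and `herr` bounds the mean
  -- of `L` by `K₀`.
  · rw [lintegral_map (by fun_prop) hXYm]
    have hsum : ∀ p, ENNReal.ofReal (L p)
        = ∑ i ∈ Finset.univ.erase i₀, ENNReal.ofReal 3 * ENNReal.ofReal (Real.log (ℓ i p.1 p.2)) :=
      fun p => by
        rw [ENNReal.ofReal_sum_of_nonneg fun i _ =>
          mul_nonneg (by norm_num) (Real.log_nonneg (hℓ1 i _ _))]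
        exact Finset.sum_congr rfl fun i _ => ENNReal.ofReal_mul (by norm_num)
    simp_rw [hsum]
    have hcomp : ∀ i, Measurable fun ω : (Fin N → ℂ) × (Fin Q × Fin Q → ℂ) ×
        (Fin Q × Fin N → ℂ) => ℓ i ω.1 (channelOutput P Q (t ^ 2) ω.1 ω.2.1 ω.2.2) :=
      fun i => by
        have h := (hℓm i).comp hXYm
        simpa only [Function.comp_def] using h
    rw [lintegral_finsetSum _ fun i _ => by have := hcomp i; fun_prop]
    refine Finset.sum_le_sum fun i _ => ?_
    rw [lintegral_const_mul' _ _ ENNReal.ofReal_ne_top]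
    refine mul_le_mul_right ((lintegral_congr fun ω => ?_).trans_le (herr i t ht)) _
    simp only [ℓ, inv_smul_channelOutput P ht0]

/-- The capacity is at least `(1 - 1 / N) * log₂ snr` up to an additive constant. -/
lemma HasSparkProperty.exists_le_capacity {P : Matrix (Fin N) (Fin Q) ℂ} (hP : HasSparkProperty P)
    (hQ : 0 < Q) (hrow : ∀ i, P.row i ≠ 0) :
    ∃ c : ℝ, ∀ snr : ℝ, 1 ≤ snr →
      (((1 - 1 / (N : ℝ)) * Real.logb 2 snr + c : ℝ) : EReal)
        ≤ ((capacity P Q snr : ℝ≥0∞) : EReal) := by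
  obtain ⟨i₀, e, b, hA, hb, hb₀⟩ := hP.exists_frame
  have hN : 0 < (N : ℝ) := by exact_mod_cast i₀.pos
  choose K hK herr using exists_lintegral_log_error_le hrow hA hb hb₀ ⟨0, hQ⟩
  obtain ⟨C, hC⟩ := exists_le_klDiv_of_log_error_le
    (measurable_recipEstimate i₀ e b ⟨0, hQ⟩) hK herr
  refine ⟨-(C / Real.log 2 / N), fun snr hsnr => ?_⟩
  have hlog2 : 0 < Real.log 2 := Real.log_pos one_lt_two
  have h := hC (Real.sqrt snr) (Real.one_le_sqrt.2 hsnr)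
  rw [Real.sq_sqrt (by linarith)] at h
  have hI : ENNReal.ofReal ((((N : ℝ) - 1) * Real.log snr - C) / Real.log 2)
      ≤ blockMutualInfo P Q snr (inputLaw i₀) := by
    rw [ENNReal.ofReal_div_of_pos hlog2]
    exact ENNReal.div_le_div_right h _
  have hcap : ENNReal.ofReal ((((N : ℝ) - 1) * Real.log snr - C) / Real.log 2 / N)
      ≤ capacity P Q snr := by
    rw [ENNReal.ofReal_div_of_pos hN, ENNReal.ofReal_natCast]
    refine ENNReal.div_le_div_right (hI.trans ?_) _
    exact le_iSup₂_of_le _ (isAdmissibleInput_inputLaw i₀) le_rfl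
  have hval : (1 - 1 / (N : ℝ)) * Real.logb 2 snr + -(C / Real.log 2 / N)
      = (((N : ℝ) - 1) * Real.log snr - C) / Real.log 2 / N := by
    rw [Real.logb]
    field_simp
    ring
  rw [hval]
  refine le_trans ?_ (EReal.coe_ennreal_le_coe_ennreal_iff.2 hcap)
  rw [EReal.coe_ennreal_ofReal]
  exact EReal.coe_le_coe_iff.2 (le_max_left _ _)

/-- The additive constant disappears after division by `logb 2 snr`, which tends to infinity. -/
lemma le_lowerPreLog {P : Matrix (Fin N) (Fin Q) ℂ} {R : ℕ} {a c : ℝ}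
    (h : ∀ᶠ snr : ℝ in atTop,
      ((a * Real.logb 2 snr + c : ℝ) : EReal) ≤ ((capacity P R snr : ℝ≥0∞) : EReal)) :
    (a : EReal) ≤ lowerPreLog P R := by
  have hlim : Tendsto (fun snr : ℝ => ((a + c / Real.logb 2 snr : ℝ) : EReal)) atTop
      (nhds (a : EReal)) := by
    refine (continuous_coe_real_ereal.tendsto a).comp ?_
    simpa using ((Real.tendsto_logb_atTop one_lt_two).const_div_atTop c).const_add a
  rw [← hlim.liminf_eq]
  refine liminf_le_liminf ?_
  filter_upwards [h, eventually_gt_atTop 1] with snr hsnr h1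
  have hl : 0 < Real.logb 2 snr := Real.logb_pos one_lt_two h1
  refine le_trans (le_of_eq ?_) (EReal.div_le_div_right_of_nonneg
    (EReal.coe_nonneg.2 hl.le) hsnr)
  rw [← EReal.coe_div]
  congr 1
  field_simp

end SIMO

theorem theorem1 (N Q : ℕ) (hQ : 0 < Q) (hQN : Q < N) (P : Matrix (Fin N) (Fin Q) ℂ)
    (hrank : P.rank = Q) (hrow : ∀ i, P.row i ≠ 0) (hP : SIMO.HasSparkProperty P) :
    (∃ c : ℝ, ∀ᶠ snr : ℝ in atTop,
      (((1 - 1 / (N : ℝ)) * Real.logb 2 snr + c : ℝ) : EReal)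
        ≤ ((SIMO.capacity P Q snr : ℝ≥0∞) : EReal)) ∧
    ((1 - 1 / (N : ℝ) : ℝ) : EReal) ≤ SIMO.lowerPreLog P Q ∧
    (1 < Q → ((1 - (Q : ℝ) / (N : ℝ) : ℝ) : EReal) < SIMO.lowerPreLog P Q) := by
  obtain ⟨c, hc⟩ := hP.exists_le_capacity hQ hrow
  have hev := (eventually_ge_atTop (1 : ℝ)).mono hc
  have hle := SIMO.le_lowerPreLog hev
  refine ⟨⟨c, hev⟩, hle, fun hQ1 => lt_of_lt_of_le (EReal.coe_lt_coe_iff.2 ?_) hle⟩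
  have hN : 0 < (N : ℝ) := by exact_mod_cast hQ.trans hQN
  have hQ1' : (1 : ℝ) < Q := by exact_mod_cast hQ1
  gcongr
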